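/- Let $n,m\ge 1$, let $D_X\in\mathbb{R}^{n\times n}$ and $D_Y\in\mathbb{R}^{m\times m}$ be symmetric matrices, and let $\mu\in\mathbb{R}^n$, $\nu\in\mathbb{R}^m$ be probability vectors (nonnegative entries summing to $1$). Equip $\mathbb{R}^{n\times m}$ with the Euclidean (Frobenius) norm $\|\cdot\|$ and inner product $\langle A,B\rangle=\mathrm{Tr}(AB^T)$. Put $$C_1=\{\pi\in\mathbb{R}^{n\times m}:\pi\ge 0,\ \pi\mathbf 1_m=\mu\},\qquad C_2=\{\pi\in\mathbb{R}^{n\times m}:\pi\ge 0,\ \pi^T\mathbf 1_n=\nu\},\qquad f(\pi)=-\mathrm{Tr}(D_X\pi D_Y\pi^T),$$ where $\pi\ge0$ is meant entrywise. Let $\mathcal N_C(\pi)=\{v:\langle v,\sigma-\pi\rangle\le 0\ \text{for all}\ \sigma\in C\}$ be the normal cone to a convex set $C$ at $\pi\in C$, let $\mathrm{Proj}_C$ be the Euclidean projection onto $C$, and let $$\mathcal X=\{\pi\in C_1\cap C_2:\ 0\in\nabla f(\pi)+\mathcal N_{C_1}(\pi)+\mathcal N_{C_2}(\pi)\}$$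 be the set of critical points of the problem $\min_{\pi\in C_1\cap C_2} f(\pi)$. Then $\mathcal X$ is nonempty, and there exist scalars $\epsilon>0$ and $\tau>0$ such that, for every $\pi\in\mathbb{R}^{n\times m}$ with $\|\pi-\mathrm{Proj}_{C_1\cap C_2}(\pi+D_X\pi D_Y)\|\le\epsilon$, $$\mathrm{dist}(\pi,\mathcal X)\le\tau\,\bigl\|\pi-\mathrm{Proj}_{C_1\cap C_2}(\pi+D_X\pi D_Y)\bigr\|,$$ where $\mathrm{dist}(\pi,\mathcal X)=\inf_{\sigma\in\mathcal X}\|\pi-\sigma\|$. -/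

import Mathlib

open scoped RealInnerProductSpace Matrix

namespace GW

/-- The space `ℝ^{n×m}` with the Euclidean (Frobenius) norm and inner product. -/
abbrev MatSpace (n m : ℕ) : Type := EuclideanSpace ℝ (Fin n × Fin m)

/-- The matrix with the entries of `π`. -/
def toMat {n m : ℕ} (π : MatSpace n m) : Matrix (Fin n) (Fin m) ℝ :=
  Matrix.of fun i j => π (i, j)

/-- The point of `MatSpace n m` with the entries of the matrix `A`. -/
def ofMat {n m : ℕ} (A : Matrix (Fin n) (Fin m) ℝ) : MatSpace n m :=
  WithLp.toLp 2 fun p => A p.1 p.2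

/-- `C₁ = {π ≥ 0 : π 1_m = μ}`. -/
def C₁ {n : ℕ} (m : ℕ) (μ : Fin n → ℝ) : Set (MatSpace n m) :=
  {π | (∀ i j, 0 ≤ toMat π i j) ∧ toMat π *ᵥ 1 = μ}

/-- `C₂ = {π ≥ 0 : πᵀ 1_n = ν}`. -/
def C₂ {m : ℕ} (n : ℕ) (ν : Fin m → ℝ) : Set (MatSpace n m) :=
  {π | (∀ i j, 0 ≤ toMat π i j) ∧ (toMat π)ᵀ *ᵥ 1 = ν}

/-- The objective `f(π) = -Tr(D_X π D_Y πᵀ)`. -/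
def objective {n m : ℕ} (DX : Matrix (Fin n) (Fin n) ℝ) (DY : Matrix (Fin m) (Fin m) ℝ)
    (π : MatSpace n m) : ℝ :=
  -(DX * toMat π * DY * (toMat π)ᵀ).trace

section Euclidean

variable {E : Type*} [NormedAddCommGroup E] [InnerProductSpace ℝ E]

/-- `p` is a nearest point to `x` in `C`. -/
def IsProj (C : Set E) (x p : E) : Prop :=
  p ∈ C ∧ ∀ y ∈ C, ‖x - p‖ ≤ ‖x - y‖

/-- The projection `argmin_{y ∈ C} ‖x - y‖` (an arbitrary value if there is no minimizer). -/
noncomputable def proj (C : Set E) (x : E) : E :=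
  Classical.epsilon (IsProj C x)

/-- The normal cone to a convex set `C` at `x` (empty for `x ∉ C`). -/
def normalCone (C : Set E) (x : E) : Set E :=
  {v | x ∈ C ∧ ∀ y ∈ C, ⟪v, y - x⟫ ≤ 0}

/-- On a nonempty closed convex set, `proj C x` is the unique nearest point. -/
theorem isProj_iff_eq_proj [CompleteSpace E] {C : Set E} (hne : C.Nonempty) (hcl : IsClosed C)
    (hconv : Convex ℝ C) (x p : E) : IsProj C x p ↔ p = proj C x := by
  have key : ∀ q, IsProj C x q → ∀ w ∈ C, ⟪x - q, w - q⟫ ≤ 0 := by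
    intro q hq
    refine (norm_eq_iInf_iff_real_inner_le_zero hconv hq.1).1 ?_
    have : Nonempty C := ⟨⟨q, hq.1⟩⟩
    refine le_antisymm (le_ciInf fun w => hq.2 w w.2) ?_
    exact ciInf_le (f := fun w : C => ‖x - w‖)
      ⟨0, by rintro _ ⟨w, rfl⟩; exact norm_nonneg _⟩ ⟨q, hq.1⟩
  have hex : ∃ q, IsProj C x q := by
    obtain ⟨q, hq, h⟩ := exists_norm_eq_iInf_of_complete_convex hne hcl.isComplete hconv x
    refine ⟨q, hq, fun y hy => ?_⟩
    rw [h]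
    exact ciInf_le (f := fun w : C => ‖x - w‖)
      ⟨0, by rintro _ ⟨w, rfl⟩; exact norm_nonneg _⟩ ⟨y, hy⟩
  have hs : IsProj C x (proj C x) := Classical.epsilon_spec hex
  refine ⟨fun hp => ?_, fun h => h ▸ hs⟩
  have h1 := key p hp _ hs.1
  have h2 := key _ hs _ hp.1
  have h3 : ⟪p - proj C x, p - proj C x⟫ ≤ 0 := by
    have : ⟪p - proj C x, p - proj C x⟫
        = ⟪x - p, proj C x - p⟫ + ⟪x - proj C x, p - proj C x⟫ := by
      have e1 : proj C x - p = -(p - proj C x) := by abel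
      rw [e1, inner_neg_right, ← sub_eq_neg_add, ← inner_sub_left]
      congr 1
      abel
    linarith
  rw [real_inner_self_eq_norm_sq] at h3
  have h4 : ‖p - proj C x‖ = 0 := by nlinarith [norm_nonneg (p - proj C x)]
  exact sub_eq_zero.1 (norm_eq_zero.1 h4)

end Euclidean

open scoped Pointwise in
/-- The critical points: `π ∈ C₁ ∩ C₂` with `0 ∈ ∇f(π) + N_{C₁}(π) + N_{C₂}(π)`. -/
def criticalSet {n m : ℕ} (DX : Matrix (Fin n) (Fin n) ℝ) (DY : Matrix (Fin m) (Fin m) ℝ)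
    (μ : Fin n → ℝ) (ν : Fin m → ℝ) : Set (MatSpace n m) :=
  {π | π ∈ C₁ m μ ∩ C₂ n ν ∧
    0 ∈ {gradient (objective DX DY) π} + normalCone (C₁ m μ) π + normalCone (C₂ n ν) π}

/-- The residual `‖π - proj_{C₁ ∩ C₂}(π + D_X π D_Y)‖`. -/
noncomputable def residual {n m : ℕ} (DX : Matrix (Fin n) (Fin n) ℝ)
    (DY : Matrix (Fin m) (Fin m) ℝ) (μ : Fin n → ℝ) (ν : Fin m → ℝ) (π : MatSpace n m) : ℝ :=
  ‖π - proj (C₁ m μ ∩ C₂ n ν) (π + ofMat (DX * toMat π * DY))‖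

end GW

/-! ### Hoffman's error bound by elimination of variables. -/

namespace GW

theorem exists_between_of_finite {α β : Type*} [Finite α] [Nonempty α] {f : α → ℝ} {g : β → ℝ}
    (h : ∀ a b, f a ≤ g b) : ∃ t, (∀ a, f a ≤ t) ∧ ∀ b, t ≤ g b := by
  obtain ⟨a, ha⟩ := Finite.exists_max f
  exact ⟨f a, ha, h a⟩

/-- Points that nearly satisfy a finite system of linear inequalities lie near its solution set;
in particular, a system with approximate solutions of arbitrarily small defect is solvable. -/
def HasLocalErrorBound (σ : Type) [Fintype σ] : Prop :=
  ∀ (κ : Type) [Finite κ] (a : κ → σ → ℝ) (b : κ → ℝ), ∃ ε > 0, ∃ τ > 0, ∀ δ, 0 ≤ δ → δ ≤ ε →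
    ∀ x : σ → ℝ, (∀ k, ∑ i, a k i * x i ≤ b k + δ) →
      ∃ y : σ → ℝ, (∀ k, ∑ i, a k i * y i ≤ b k) ∧ ∀ i, |y i - x i| ≤ τ * δ

theorem HasLocalErrorBound.of_isEmpty (σ : Type) [Fintype σ] [IsEmpty σ] :
    HasLocalErrorBound σ := by
  intro κ _ a b
  by_cases hb : ∀ k, 0 ≤ b k
  · exact ⟨1, one_pos, 1, one_pos, fun δ _ _ x _ => ⟨x, by simpa using hb, by simp⟩⟩
  · push Not at hb
    obtain ⟨k, hk⟩ := hb
    -- This `ε` is smaller than the defect `-b k` of the violated row, so no `x` qualifies.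
    refine ⟨-b k / 2, by linarith, 1, one_pos, fun δ _ hδ x hx => ?_⟩
    have := hx k
    simp only [Finset.univ_eq_empty, Finset.sum_empty] at this
    linarith

theorem HasLocalErrorBound.equiv {σ σ' : Type} [Fintype σ] [Fintype σ'] (e : σ ≃ σ')
    (h : HasLocalErrorBound σ) : HasLocalErrorBound σ' := by
  intro κ _ a b
  obtain ⟨ε, hε, τ, hτ, H⟩ := h κ (fun k i => a k (e i)) b
  refine ⟨ε, hε, τ, hτ, fun δ h0 hδ x hx => ?_⟩
  obtain ⟨y, hy, hxy⟩ := H δ h0 hδ (x ∘ e) fun k => by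
    simpa using (e.sum_comp fun i => a k i * x i).trans_le (hx k)
  refine ⟨y ∘ e.symm, fun k => ?_, fun i => by simpa using hxy (e.symm i)⟩
  rw [← e.sum_comp]
  simpa using hy k

/-- The inductive step eliminates one variable by the Fourier–Motzkin method. -/
theorem HasLocalErrorBound.option {σ : Type} [Fintype σ] (h : HasLocalErrorBound σ) :
    HasLocalErrorBound (Option σ) := by
  intro κ _ a b
  have := Fintype.ofFinite κ
  let c : κ → ℝ := fun k => a k none
  let a' : κ → σ → ℝ := fun k i => a k (some i)
  let Z := {k // c k = 0}
  let P := {k // 0 < c k}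
  let N := {k // c k < 0}
  obtain ⟨ε, hε, τ, hτ, H⟩ := h (Z ⊕ P × N)
    (Sum.elim (fun k => a' k) fun q i => -c q.2 * a' q.1 i + c q.1 * a' q.2 i)
    (Sum.elim (fun k => b k) fun q => -c q.2 * b q.1 + c q.1 * b q.2)
  -- `L` bounds the growth of the defect when two rows are combined, `B` the growth when `y`
  -- replaces the old coordinates of `x`, and `C` the resulting shift of the eliminated variable,
  -- all relative to `δ`.
  let L : ℝ := 1 + 2 * ∑ k, |c k|
  have hc : ∀ k, |c k| ≤ ∑ k, |c k| := fun k =>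
    Finset.single_le_sum (f := fun k => |c k|) (fun _ _ => abs_nonneg _) (Finset.mem_univ k)
  have hL : 1 ≤ L := by
    have : 0 ≤ ∑ k, |c k| := Finset.sum_nonneg fun _ _ => abs_nonneg _
    simp only [L]; linarith
  let A : ℝ := ∑ k, ∑ i, |a' k i|
  have hA : ∀ k, ∑ i, |a' k i| ≤ A := fun k =>
    Finset.single_le_sum (f := fun k => ∑ i, |a' k i|)
      (fun _ _ => Finset.sum_nonneg fun _ _ => abs_nonneg _) (Finset.mem_univ k)
  have hA0 : 0 ≤ A := Finset.sum_nonneg fun _ _ => Finset.sum_nonneg fun _ _ => abs_nonneg _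
  let B : ℝ := 1 + A * (τ * L)
  have hB : 0 ≤ B := by positivity
  let C : ℝ := ∑ k, B / |c k|
  have hC : ∀ k, B / |c k| ≤ C := fun k =>
    Finset.single_le_sum (f := fun k => B / |c k|) (fun _ _ => by positivity) (Finset.mem_univ k)
  have hC0 : 0 ≤ C := Finset.sum_nonneg fun _ _ => by positivity
  refine ⟨ε / L, by positivity, τ * L + C, by positivity, fun δ h0 hδ x hx => ?_⟩
  simp only [Fintype.sum_option] at hx ⊢
  change ∀ k, c k * x none + ∑ i, a' k i * x (some i) ≤ b k + δ at hx
  change ∃ y : Option σ → ℝ, (∀ k, c k * y none + ∑ i, a' k i * y (some i) ≤ b k) ∧ _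
  have hLδ : L * δ ≤ ε := by rwa [le_div_iff₀' (by positivity)] at hδ
  obtain ⟨y, hy, hxy⟩ := H (L * δ) (by positivity) hLδ (fun i => x (some i)) (by
    rintro (k | ⟨p, q⟩)
    · have h1 := hx k
      rw [k.2] at h1
      simp only [Sum.elim_inl]
      nlinarith
    · have h1 := mul_le_mul_of_nonneg_left (hx p) (neg_nonneg.2 q.2.le)
      have h2 := mul_le_mul_of_nonneg_left (hx q) p.2.le
      have h3 := hc p
      have h4 := hc q
      rw [abs_of_pos p.2] at h3
      rw [abs_of_neg q.2] at h4
      simp only [Sum.elim_inr, add_mul, Finset.sum_add_distrib, mul_assoc, ← Finset.mul_sum]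
      have h5 : (-c q + c p) * δ ≤ L * δ :=
        mul_le_mul_of_nonneg_right (by simp only [L]; linarith) h0
      linarith)
  have hyZ : ∀ k, c k = 0 → ∑ i, a' k i * y i ≤ b k := fun k hk => hy (.inl ⟨k, hk⟩)
  have hyPN : ∀ p q, 0 < c p → c q < 0 →
      -c q * ∑ i, a' p i * y i + c p * ∑ i, a' q i * y i ≤ -c q * b p + c p * b q := by
    intro p q hp hq
    have := hy (.inr (⟨p, hp⟩, ⟨q, hq⟩))
    simpa only [Sum.elim_inr, add_mul, Finset.sum_add_distrib, mul_assoc, ← Finset.mul_sum]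
      using this
  have hdef : ∀ k, c k * x none + ∑ i, a' k i * y i ≤ b k + B * δ := by
    intro k
    have h1 : ∑ i, a' k i * y i - ∑ i, a' k i * x (some i) ≤ A * (τ * (L * δ)) := by
      rw [← Finset.sum_sub_distrib]
      calc ∑ i, (a' k i * y i - a' k i * x (some i))
          ≤ ∑ i, |a' k i| * (τ * (L * δ)) := Finset.sum_le_sum fun i _ => by
            rw [← mul_sub]
            refine (le_abs_self _).trans ?_
            rw [abs_mul]
            exact mul_le_mul_of_nonneg_left (hxy i) (abs_nonneg _)
        _ = (∑ i, |a' k i|) * (τ * (L * δ)) := by rw [Finset.sum_mul]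
        _ ≤ _ := mul_le_mul_of_nonneg_right (hA k) (by positivity)
    have h2 := hx k
    simp only [B]
    linarith
  let g : κ → ℝ := fun k => (b k - ∑ i, a' k i * y i) / c k
  -- The `none` entries add the window of radius `C * δ` about `x none` to the bounds from the rows,
  -- so `t` is both feasible and close.
  obtain ⟨t, htl, htu⟩ := exists_between_of_finite
    (f := fun o : Option N => o.elim (x none - C * δ) fun k => g k)
    (g := fun o : Option P => o.elim (x none + C * δ) fun k => g k) (by
      rintro (_ | ⟨q, hq⟩) (_ | ⟨p, hp⟩) <;> simp only [Option.elim, g]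
      · nlinarith
      · rw [le_div_iff₀ hp]
        have h1 := hdef p
        have h2 := hC p
        rw [abs_of_pos hp, div_le_iff₀ hp] at h2
        nlinarith
      · rw [div_le_iff_of_neg hq]
        have h1 := hdef q
        have h2 := hC q
        rw [abs_of_neg hq, div_le_iff₀ (neg_pos.2 hq)] at h2
        nlinarith
      · rw [div_le_iff_of_neg hq, div_mul_eq_mul_div, div_le_iff₀ hp]
        have := hyPN p q hp hq
        linarith)
  refine ⟨fun o => o.elim t y, fun k => ?_, ?_⟩
  · rcases lt_trichotomy (c k) 0 with hk | hk | hk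
    · have := htl (some ⟨k, hk⟩)
      simp only [Option.elim, g, div_le_iff_of_neg hk] at this ⊢
      linarith
    · simpa [hk] using hyZ k hk
    · have := htu (some ⟨k, hk⟩)
      simp only [Option.elim, g, le_div_iff₀ hk] at this ⊢
      linarith
  · have hCδ : 0 ≤ C * δ := by positivity
    have hτδ : 0 ≤ τ * (L * δ) := by positivity
    rintro (_ | i)
    · have h1 := htl none
      have h2 := htu none
      simp only [Option.elim] at h1 h2 ⊢
      rw [abs_le]
      constructor <;> linarith
    · have := hxy i
      simp only [Option.elim]
      linarith

theorem hasLocalErrorBound (σ : Type) [Fintype σ] : HasLocalErrorBound σ := by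
  suffices h : ∀ [Fintype σ], HasLocalErrorBound σ from h
  induction σ using Finite.induction_empty_option with
  | of_equiv e ih =>
    intro _
    have := Fintype.ofEquiv _ e.symm
    exact HasLocalErrorBound.equiv e ih
  | h_empty => exact HasLocalErrorBound.of_isEmpty _
  | h_option ih =>
    intro _
    convert HasLocalErrorBound.option ih

/-! ### Hoffman's bound in finite-dimensional spaces. -/

section

variable {V : Type*} [NormedAddCommGroup V] [NormedSpace ℝ V] [FiniteDimensional ℝ V]

/-- **Hoffman's error bound** for small defects, on a finite-dimensional space. -/
theorem exists_local_error_bound {κ : Type} [Finite κ] (a : κ → V →ₗ[ℝ] ℝ) (b : κ → ℝ) :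
    ∃ ε > 0, ∃ τ > 0, ∀ δ, 0 ≤ δ → δ ≤ ε → ∀ x, (∀ k, a k x ≤ b k + δ) →
      ∃ y, (∀ k, a k y ≤ b k) ∧ ‖y - x‖ ≤ τ * δ := by
  let e := (Module.finBasis ℝ V).equivFun.toContinuousLinearEquiv
  obtain ⟨ε, hε, τ, hτ, H⟩ := hasLocalErrorBound (Fin (Module.finrank ℝ V)) κ
    (fun k i => a k (Module.finBasis ℝ V i)) b
  have hsum : ∀ k (w : Fin (Module.finrank ℝ V) → ℝ),
      a k (e.symm w) = ∑ i, a k (Module.finBasis ℝ V i) * w i := by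
    intro k w
    have : e.symm w = ∑ i, w i • Module.finBasis ℝ V i :=
      (Module.finBasis ℝ V).equivFun_symm_apply w
    rw [this, map_sum]
    exact Finset.sum_congr rfl fun i _ => by rw [map_smul, smul_eq_mul, mul_comm]
  refine ⟨ε, hε, (‖e.symm.toContinuousLinearMap‖ + 1) * τ, by positivity, fun δ h0 hδ x hx => ?_⟩
  obtain ⟨y, hy, hxy⟩ := H δ h0 hδ (e x) fun k => by
    rw [← hsum, e.symm_apply_apply]; exact hx k
  refine ⟨e.symm y, fun k => by rw [hsum]; exact hy k, ?_⟩
  have h1 : e.symm y - x = e.symm.toContinuousLinearMap (y - e x) := by simp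
  have h2 : ‖y - e x‖ ≤ τ * δ := (pi_norm_le_iff_of_nonneg (by positivity)).2 hxy
  rw [h1, mul_assoc]
  refine (ContinuousLinearMap.le_opNorm _ _).trans ?_
  gcongr
  linarith

/-- Hoffman's error bound for small defects, for a system of inequalities and equations. -/
theorem exists_local_error_bound_of_eq {κ η : Type} [Finite κ] [Finite η] (a : κ → V →ₗ[ℝ] ℝ)
    (b : κ → ℝ) (a' : η → V →ₗ[ℝ] ℝ) (b' : η → ℝ) :
    ∃ ε > 0, ∃ τ > 0, ∀ δ, 0 ≤ δ → δ ≤ ε → ∀ x, (∀ k, a k x ≤ b k + δ) →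
      (∀ k, |a' k x - b' k| ≤ δ) →
      ∃ y, (∀ k, a k y ≤ b k) ∧ (∀ k, a' k y = b' k) ∧ ‖y - x‖ ≤ τ * δ := by
  obtain ⟨ε, hε, τ, hτ, H⟩ := exists_local_error_bound
    (Sum.elim a (Sum.elim a' fun k => -a' k)) (Sum.elim b (Sum.elim b' fun k => -b' k))
  refine ⟨ε, hε, τ, hτ, fun δ h0 hδ x hx hx' => ?_⟩
  obtain ⟨y, hy, hxy⟩ := H δ h0 hδ x (by
    rintro (k | k | k)
    · exact hx k
    · have := abs_le.1 (hx' k)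
      simp only [Sum.elim_inr, Sum.elim_inl]
      linarith
    · have := abs_le.1 (hx' k)
      simp only [Sum.elim_inr, LinearMap.neg_apply]
      linarith)
  refine ⟨y, fun k => hy (.inl k), fun k => le_antisymm (hy (.inr (.inl k))) ?_, hxy⟩
  simpa using hy (.inr (.inr k))

end

end GW

/-! ### The transportation polytope and multipliers for its normals. -/

namespace GW

variable {n m : ℕ} {μ : Fin n → ℝ} {ν : Fin m → ℝ}

theorem mem_C₁_iff {π : MatSpace n m} :
    π ∈ C₁ m μ ↔ (∀ i j, 0 ≤ π (i, j)) ∧ ∀ i, ∑ j, π (i, j) = μ i := by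
  simp [C₁, toMat, funext_iff, Matrix.mulVec, dotProduct]

theorem mem_C₂_iff {π : MatSpace n m} :
    π ∈ C₂ n ν ↔ (∀ i j, 0 ≤ π (i, j)) ∧ ∀ j, ∑ i, π (i, j) = ν j := by
  simp [C₂, toMat, funext_iff, Matrix.mulVec, dotProduct]

theorem inner_eq_sum (x y : MatSpace n m) : ⟪x, y⟫ = ∑ i, ∑ j, x (i, j) * y (i, j) := by
  rw [PiLp.inner_apply, Fintype.sum_prod_type]
  simp [mul_comm]

theorem convex_inter : Convex ℝ (C₁ m μ ∩ C₂ n ν) := by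
  rintro x ⟨hx1, hx2⟩ y ⟨hy1, hy2⟩ a b ha hb hab
  simp only [mem_C₁_iff, mem_C₂_iff] at *
  have h : ∀ i j, 0 ≤ (a • x + b • y) (i, j) := fun i j => by
    simpa using add_nonneg (mul_nonneg ha (hx1.1 i j)) (mul_nonneg hb (hy1.1 i j))
  rw [Set.mem_inter_iff, mem_C₁_iff, mem_C₂_iff]
  refine ⟨⟨h, fun i => ?_⟩, h, fun j => ?_⟩
  · simp [Finset.sum_add_distrib, ← Finset.mul_sum, hx1.2, hy1.2, ← add_mul, hab]
  · simp [Finset.sum_add_distrib, ← Finset.mul_sum, hx2.2, hy2.2, ← add_mul, hab]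

theorem isClosed_inter : IsClosed (C₁ m μ ∩ C₂ n ν) := by
  have h : C₁ m μ ∩ C₂ n ν = {π | ((∀ i j, 0 ≤ π (i, j)) ∧ ∀ i, ∑ j, π (i, j) = μ i) ∧
      (∀ i j, 0 ≤ π (i, j)) ∧ ∀ j, ∑ i, π (i, j) = ν j} := by
    ext π; rw [Set.mem_inter_iff, mem_C₁_iff, mem_C₂_iff]; rfl
  rw [h]
  simp only [Set.ofPred_and, Set.ofPred_forall]
  have hpos : IsClosed (⋂ i, ⋂ j, {π : MatSpace n m | 0 ≤ π (i, j)}) :=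
    isClosed_iInter fun i => isClosed_iInter fun j =>
      isClosed_le continuous_const (by fun_prop)
  exact (hpos.inter (isClosed_iInter fun i => isClosed_eq (by fun_prop) continuous_const)).inter
    (hpos.inter (isClosed_iInter fun j => isClosed_eq (by fun_prop) continuous_const))

theorem isCompact_inter : IsCompact (C₁ m μ ∩ C₂ n ν) := by
  refine Metric.isCompact_of_isClosed_isBounded isClosed_inter
    (isBounded_iff_forall_norm_le.2 ⟨∑ i, |μ i|, fun π ⟨hπ, _⟩ => ?_⟩)
  rw [mem_C₁_iff] at hπ
  calc ‖π‖ = ‖∑ q, EuclideanSpace.single q (π q)‖ := by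
        congr 1; ext q; simp [Finset.sum_apply]
    _ ≤ ∑ q, ‖EuclideanSpace.single q (π q)‖ := norm_sum_le _ _
    _ = ∑ i, ∑ j, π (i, j) := by
        rw [Fintype.sum_prod_type]
        exact Finset.sum_congr rfl fun i _ => Finset.sum_congr rfl fun j _ => by
          simp [abs_of_nonneg (hπ.1 i j)]
    _ ≤ _ := Finset.sum_le_sum fun i _ => by rw [hπ.2]; exact le_abs_self _

theorem nonempty_inter (hμ : μ ∈ stdSimplex ℝ (Fin n)) (hν : ν ∈ stdSimplex ℝ (Fin m)) :
    (C₁ m μ ∩ C₂ n ν).Nonempty := by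
  refine ⟨ofMat (Matrix.of fun i j => μ i * ν j), ?_⟩
  rw [Set.mem_inter_iff, mem_C₁_iff, mem_C₂_iff]
  have h : ∀ i j, 0 ≤ μ i * ν j := fun i j => mul_nonneg (hμ.1 i) (hν.1 j)
  exact ⟨⟨h, fun i => by simp [ofMat, ← Finset.mul_sum, hν.2]⟩, h,
    fun j => by simp [ofMat, ← Finset.sum_mul, hμ.2]⟩

/-- The vectors bounded by some `u ⊕ v`, with equality off `Z`. -/
def multiplierCone (Z : Set (Fin n × Fin m)) : Set (MatSpace n m) :=
  {c | ∃ (u : Fin n → ℝ) (v : Fin m → ℝ), (∀ i j, c (i, j) ≤ u i + v j) ∧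
    ∀ i j, (i, j) ∉ Z → c (i, j) = u i + v j}

/-- The functional `(u, v) ↦ u i + v j`. -/
def sumFunctional (q : Fin n × Fin m) : ((Fin n → ℝ) × (Fin m → ℝ)) →ₗ[ℝ] ℝ :=
  (LinearMap.proj q.1).coprod (LinearMap.proj q.2)

@[simp] theorem sumFunctional_apply (q : Fin n × Fin m) (z : (Fin n → ℝ) × (Fin m → ℝ)) :
    sumFunctional q z = z.1 q.1 + z.2 q.2 := rfl

/-- Multipliers of a nearby cone element solve the linear system for `c` with small defect, so
Hoffman's bound makes that system solvable. -/
theorem isClosed_multiplierCone (Z : Set (Fin n × Fin m)) : IsClosed (multiplierCone Z) := by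
  refine isClosed_of_closure_subset fun c hc => ?_
  obtain ⟨ε, hε, τ, -, H⟩ := exists_local_error_bound_of_eq (κ := Fin n × Fin m) (η := ↥Zᶜ)
    (fun q => -sumFunctional q) (fun q => -c q) (fun q => sumFunctional (q : Fin n × Fin m))
    fun q => c q
  obtain ⟨c', ⟨u, v, hle, heq⟩, hcc'⟩ := Metric.mem_closure_iff.1 hc ε hε
  have hd : ∀ q, |c q - c' q| ≤ ε := fun q => by
    have := PiLp.norm_apply_le (c - c') q
    rw [dist_eq_norm] at hcc'
    exact (by simpa using this : |c q - c' q| ≤ _).trans hcc'.le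
  obtain ⟨⟨u', v'⟩, h1, h2, -⟩ := H ε hε.le le_rfl (u, v)
    (fun q => by
      have := abs_le.1 (hd q)
      have := hle q.1 q.2
      simp only [LinearMap.neg_apply, sumFunctional_apply]
      linarith)
    (fun q => by
      have := heq q.1.1 q.1.2 q.2
      simp only [sumFunctional_apply, ← this]
      rw [abs_sub_comm]
      exact hd q)
  exact ⟨u', v', fun i j => by simpa [add_comm] using h1 (i, j),
    fun i j hij => by simpa using (h2 ⟨(i, j), hij⟩).symm⟩

theorem smul_mem_multiplierCone {Z : Set (Fin n × Fin m)} {c : MatSpace n m}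
    (hc : c ∈ multiplierCone Z) {t : ℝ} (ht : 0 ≤ t) : t • c ∈ multiplierCone Z := by
  obtain ⟨u, v, h1, h2⟩ := hc
  refine ⟨t • u, t • v, fun i j => ?_, fun i j hij => ?_⟩
  · simpa [mul_add] using mul_le_mul_of_nonneg_left (h1 i j) ht
  · simp [mul_add, h2 i j hij]

theorem add_mem_multiplierCone {Z : Set (Fin n × Fin m)} {c d : MatSpace n m}
    (hc : c ∈ multiplierCone Z) (hd : d ∈ multiplierCone Z) : c + d ∈ multiplierCone Z := by
  obtain ⟨u, v, h1, h2⟩ := hc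
  obtain ⟨u', v', h1', h2'⟩ := hd
  refine ⟨u + u', v + v', fun i j => ?_, fun i j hij => ?_⟩
  · have := h1 i j
    have := h1' i j
    simp only [PiLp.add_apply, Pi.add_apply]
    linarith
  · simp only [PiLp.add_apply, Pi.add_apply, h2 i j hij, h2' i j hij]
    ring

theorem convex_multiplierCone (Z : Set (Fin n × Fin m)) : Convex ℝ (multiplierCone Z) :=
  fun _ hx _ hy _ _ ha hb _ =>
    add_mem_multiplierCone (smul_mem_multiplierCone hx ha) (smul_mem_multiplierCone hy hb)

open Filter Topology in
/-- Normal vectors to the transportation polytope have Lagrange multipliers. -/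
theorem mem_multiplierCone_of_inner_le {p c : MatSpace n m} (hp : p ∈ C₁ m μ ∩ C₂ n ν)
    (hc : ∀ y ∈ C₁ m μ ∩ C₂ n ν, ⟪c, y - p⟫ ≤ 0) : c ∈ multiplierCone {q | p q = 0} := by
  by_contra hnot
  obtain ⟨f, s, hfs, hsc⟩ := geometric_hahn_banach_closed_point
    (convex_multiplierCone _) (isClosed_multiplierCone _) hnot
  have h0 : (0 : MatSpace n m) ∈ multiplierCone {q | p q = 0} := ⟨0, 0, by simp, by simp⟩
  have hs : 0 < s := by simpa using hfs 0 h0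
  have hf : ∀ x ∈ multiplierCone {q | p q = 0}, f x ≤ 0 := by
    intro x hx
    by_contra! hpos
    have := hfs _ (smul_mem_multiplierCone hx (t := s / f x) (by positivity))
    rw [map_smul, smul_eq_mul, div_mul_cancel₀ _ hpos.ne'] at this
    exact lt_irrefl _ this
  -- The separating direction `d` has zero row and column sums and is nonnegative where `p`
  -- vanishes. So `p + t • d` is feasible for small `t > 0`, contradicting `hc` since `⟪c, d⟫ > 0`.
  let d : MatSpace n m := (InnerProductSpace.toDual ℝ _).symm f
  have hd : ∀ x, f x = ∑ i, ∑ j, d (i, j) * x (i, j) := fun x => by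
    rw [← inner_eq_sum, InnerProductSpace.toDual_symm_apply]
  have huv : ∀ (u : Fin n → ℝ) (v : Fin m → ℝ), ∑ i, ∑ j, d (i, j) * (u i + v j) = 0 := by
    intro u v
    have key : ∀ (u : Fin n → ℝ) (v : Fin m → ℝ), ∑ i, ∑ j, d (i, j) * (u i + v j) ≤ 0 := by
      intro u v
      have := hf (ofMat (Matrix.of fun i j => u i + v j))
        ⟨u, v, fun i j => le_rfl, fun i j _ => rfl⟩
      rwa [hd] at this
    refine le_antisymm (key u v) ?_
    have := key (-u) (-v)
    simp only [Pi.neg_apply, ← neg_add, mul_neg, Finset.sum_neg_distrib] at this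
    linarith
  have hrow : ∀ i, ∑ j, d (i, j) = 0 := fun i => by
    have := huv (Pi.single i 1) 0
    simpa [Pi.single_apply, ← Finset.sum_mul, Finset.sum_ite_eq] using this
  have hcol : ∀ j, ∑ i, d (i, j) = 0 := fun j => by
    have := huv 0 (Pi.single j 1)
    simpa [Pi.single_apply] using this
  have hdpos : ∀ i j, p (i, j) = 0 → 0 ≤ d (i, j) := by
    intro i j hij
    have := hf (-EuclideanSpace.single (i, j) 1) ⟨0, 0, fun i' j' => by
        by_cases h : (i', j') = (i, j) <;> simp [h],
      fun i' j' h => by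
        have : (i', j') ≠ (i, j) := fun e => h (by simpa [e] using hij)
        simp [this]⟩
    rw [← InnerProductSpace.toDual_symm_apply, inner_neg_right,
      EuclideanSpace.inner_single_right] at this
    simpa [d] using this
  rw [Set.mem_inter_iff, mem_C₁_iff, mem_C₂_iff] at hp
  have hev : ∀ᶠ t : ℝ in 𝓝[>] 0, ∀ i j, 0 ≤ p (i, j) + t * d (i, j) := by
    refine eventually_all.2 fun i => eventually_all.2 fun j => ?_
    rcases (hp.1.1 i j).eq_or_lt with h | h
    · filter_upwards [self_mem_nhdsWithin] with t ht
      rw [← h, zero_add]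
      exact mul_nonneg (le_of_lt ht) (hdpos i j h.symm)
    · have : Tendsto (fun t : ℝ => p (i, j) + t * d (i, j)) (𝓝[>] 0) (𝓝 (p (i, j))) := by
        have : Continuous fun t : ℝ => p (i, j) + t * d (i, j) := by fun_prop
        simpa using (this.tendsto 0).mono_left nhdsWithin_le_nhds
      exact (this.eventually (lt_mem_nhds h)).mono fun _ => le_of_lt
  obtain ⟨t, ht, ht0⟩ := (hev.and self_mem_nhdsWithin).exists
  have hle := hc (p + t • d) (by
    rw [Set.mem_inter_iff, mem_C₁_iff, mem_C₂_iff]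
    refine ⟨⟨by simpa using ht, fun i => ?_⟩, by simpa using ht, fun j => ?_⟩
    · simp [Finset.sum_add_distrib, ← Finset.mul_sum, hrow, hp.1.2]
    · simp [Finset.sum_add_distrib, ← Finset.mul_sum, hcol, hp.2.2])
  have hfc : f c = ⟪c, d⟫ := by
    rw [real_inner_comm, InnerProductSpace.toDual_symm_apply]
  rw [add_sub_cancel_left, inner_smul_right, ← hfc] at hle
  have : 0 < t * f c := mul_pos ht0 (hs.trans hsc)
  linarith

/-! ### Gradient of the objective and critical points. -/

variable (DX : Matrix (Fin n) (Fin n) ℝ) (DY : Matrix (Fin m) (Fin m) ℝ)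

/-- The linear map `π ↦ D_X π D_Y`. -/
def sandwich : MatSpace n m →ₗ[ℝ] MatSpace n m where
  toFun π := ofMat (DX * toMat π * DY)
  map_add' π σ := by
    have : toMat (π + σ) = toMat π + toMat σ := rfl
    rw [this, Matrix.mul_add, Matrix.add_mul]; rfl
  map_smul' t π := by
    have : toMat (t • π) = t • toMat π := rfl
    rw [this, Matrix.mul_smul, Matrix.smul_mul]; rfl

theorem inner_eq_trace (x y : MatSpace n m) : ⟪x, y⟫ = (toMat x * (toMat y)ᵀ).trace := by
  simp [inner_eq_sum, Matrix.trace, Matrix.mul_apply, toMat]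

theorem objective_eq (π : MatSpace n m) : objective DX DY π = -⟪sandwich DX DY π, π⟫ := by
  rw [inner_eq_trace]; rfl

variable {DX DY}

theorem inner_sandwich_comm (hDX : DX.IsSymm) (hDY : DY.IsSymm) (x y : MatSpace n m) :
    ⟪sandwich DX DY x, y⟫ = ⟪sandwich DX DY y, x⟫ := by
  rw [inner_eq_trace, inner_eq_trace]
  change (DX * toMat x * DY * (toMat y)ᵀ).trace = (DX * toMat y * DY * (toMat x)ᵀ).trace
  rw [← Matrix.trace_transpose]
  simp only [Matrix.transpose_mul, Matrix.transpose_transpose, hDX.eq, hDY.eq]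
  rw [← Matrix.mul_assoc, ← Matrix.mul_assoc, Matrix.trace_mul_comm, ← Matrix.mul_assoc,
    ← Matrix.mul_assoc]

theorem hasGradientAt_objective (hDX : DX.IsSymm) (hDY : DY.IsSymm) (p : MatSpace n m) :
    HasGradientAt (objective DX DY) (-(2 : ℝ) • sandwich DX DY p) p := by
  let A := (sandwich DX DY).toContinuousLinearMap
  have h : HasFDerivAt (fun π => -⟪A π, π⟫) _ p := (A.hasFDerivAt.inner ℝ (hasFDerivAt_id p)).neg
  rw [hasGradientAt_iff_hasFDerivAt]
  have he : objective DX DY = fun π => -⟪A π, π⟫ := funext (objective_eq DX DY)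
  rw [he]
  refine h.congr_fderiv ?_
  ext d
  have := inner_sandwich_comm hDX hDY d p
  simp only [InnerProductSpace.toDual_apply_apply, inner_smul_left, neg_apply]
  simp [A, this, fderivInnerCLM_apply, two_mul]

/-- Feasible points with complementary multipliers are critical. -/
theorem mem_criticalSet (hDX : DX.IsSymm) (hDY : DY.IsSymm) {p : MatSpace n m}
    (hp : p ∈ C₁ m μ ∩ C₂ n ν) (hm : sandwich DX DY p ∈ multiplierCone {q | p q = 0}) :
    p ∈ criticalSet DX DY μ ν := by
  obtain ⟨u, v, hle, heq⟩ := hm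
  -- `w₂` is constant on columns, hence orthogonal to differences in `C₂`. The rest, `w₁`, is at
  -- most `2 * u i`, with equality on the support of `p`, so it is normal to `C₁`.
  let w₂ : MatSpace n m := ofMat (Matrix.of fun _ j => 2 * v j)
  let w₁ : MatSpace n m := (2 : ℝ) • sandwich DX DY p - w₂
  have hp' := hp
  rw [Set.mem_inter_iff, mem_C₁_iff, mem_C₂_iff] at hp'
  refine ⟨hp, _, ⟨_, rfl, w₁, ⟨hp.1, fun y hy => ?_⟩, rfl⟩, w₂, ⟨hp.2, fun y hy => ?_⟩, ?_⟩
  · rw [mem_C₁_iff] at hy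
    have hb : ∀ i j, w₁ (i, j) * (y - p) (i, j) ≤ 2 * u i * (y (i, j) - p (i, j)) := by
      intro i j
      simp only [w₁, w₂, ofMat, Matrix.of_apply, PiLp.sub_apply, PiLp.smul_apply, smul_eq_mul]
      by_cases h : p (i, j) = 0
      · rw [h, sub_zero]
        exact mul_le_mul_of_nonneg_right (by linarith [hle i j]) (hy.1 i j)
      · rw [heq i j h]
        exact le_of_eq (by ring)
    calc ⟪w₁, y - p⟫ ≤ ∑ i, ∑ j, 2 * u i * (y (i, j) - p (i, j)) := by
          rw [inner_eq_sum]
          exact Finset.sum_le_sum fun i _ => Finset.sum_le_sum fun j _ => hb i j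
      _ = 0 := by simp [← Finset.mul_sum, hy.2, hp'.1.2]
      _ ≤ 0 := le_rfl
  · rw [mem_C₂_iff] at hy
    rw [inner_eq_sum, Finset.sum_comm]
    simp [w₂, ofMat, ← Finset.mul_sum, hy.2, hp'.2.2]
  · simp only [(hasGradientAt_objective hDX hDY p).gradient, w₁]
    module

/-- A minimizer exists by compactness; its first-order condition along segments makes `A p` normal
to the polytope, and multipliers split that normal. -/
theorem nonempty_criticalSet (hDX : DX.IsSymm) (hDY : DY.IsSymm)
    (hμ : μ ∈ stdSimplex ℝ (Fin n)) (hν : ν ∈ stdSimplex ℝ (Fin m)) :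
    (criticalSet DX DY μ ν).Nonempty := by
  have hd := fun p => (hasGradientAt_objective hDX hDY p).hasFDerivAt
  have hcont : Continuous (objective DX DY) :=
    continuous_iff_continuousAt.2 fun p => (hd p).continuousAt
  obtain ⟨p, hp, hmin⟩ := isCompact_inter.exists_isMinOn (nonempty_inter hμ hν) hcont.continuousOn
  refine ⟨p, mem_criticalSet hDX hDY hp (mem_multiplierCone_of_inner_le hp fun y hy => ?_)⟩
  have := hmin.localize.hasFDerivWithinAt_nonneg (hd p).hasFDerivWithinAt
    (sub_mem_posTangentConeAt_of_segment_subset (convex_inter.segment_subset hp hy))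
  rw [InnerProductSpace.toDual_apply_apply, inner_smul_left] at this
  simp at this
  linarith

end GW

/-! ### Error bound for each zero pattern. -/

namespace GW

variable {n m : ℕ} {μ : Fin n → ℝ} {ν : Fin m → ℝ} {DX : Matrix (Fin n) (Fin n) ℝ}
  {DY : Matrix (Fin m) (Fin m) ℝ}

/-- Approximately critical points with a given zero pattern are close to critical points. -/
theorem exists_error_bound_of_pattern (hDX : DX.IsSymm) (hDY : DY.IsSymm) (μ : Fin n → ℝ)
    (ν : Fin m → ℝ) (Z : Set (Fin n × Fin m)) :
    ∃ ε > 0, ∃ τ > 0, ∀ δ, 0 ≤ δ → δ ≤ ε → ∀ p ∈ C₁ m μ ∩ C₂ n ν, (∀ q ∈ Z, p q = 0) →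
      ∀ w : MatSpace n m, ‖w‖ ≤ δ → sandwich DX DY p + w ∈ multiplierCone Z →
        ∃ p' ∈ criticalSet DX DY μ ν, ‖p' - p‖ ≤ τ * δ := by
  classical
  let V := MatSpace n m × (Fin n → ℝ) × (Fin m → ℝ)
  let e : Fin n × Fin m → V →ₗ[ℝ] ℝ := fun q =>
    (EuclideanSpace.proj (𝕜 := ℝ) q).toLinearMap ∘ₗ LinearMap.fst ℝ _ _
  let g : Fin n × Fin m → V →ₗ[ℝ] ℝ := fun q =>
    (EuclideanSpace.proj (𝕜 := ℝ) q).toLinearMap ∘ₗ sandwich DX DY ∘ₗ LinearMap.fst ℝ _ _ -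
      sumFunctional q ∘ₗ LinearMap.snd ℝ _ _
  have he : ∀ q (z : V), e q z = z.1 q := fun _ _ => rfl
  have hg : ∀ q (z : V), g q z = sandwich DX DY z.1 q - (z.2.1 q.1 + z.2.2 q.2) := fun _ _ => rfl
  -- The system in `(p, u, v)`: `p` is feasible and zero on `Z`, and `A p ≤ u ⊕ v` with equality off
  -- `Z`. Only the `g` rows carry a defect, namely the entries of `w`.
  obtain ⟨ε, hε, τ, hτ, H⟩ := exists_local_error_bound_of_eq
    (κ := (Fin n × Fin m) ⊕ (Fin n × Fin m)) (η := (Fin n × Fin m) ⊕ Fin n ⊕ Fin m)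
    (Sum.elim (fun q => -e q) g) 0
    (Sum.elim (fun q => if q ∈ Z then e q else g q)
      (Sum.elim (fun i => ∑ j, e (i, j)) fun j => ∑ i, e (i, j)))
    (Sum.elim 0 (Sum.elim μ ν))
  refine ⟨ε, hε, τ, hτ, fun δ h0 hδ p hp hpZ w hw ⟨u, v, hle, heq⟩ => ?_⟩
  have hp' := hp
  rw [Set.mem_inter_iff, mem_C₁_iff, mem_C₂_iff] at hp'
  have hwq : ∀ q, |w q| ≤ δ := fun q => by
    simpa using (PiLp.norm_apply_le w q).trans hw
  obtain ⟨⟨p', u', v'⟩, h1, h2, h3⟩ := H δ h0 hδ (p, u, v)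
    (by
      rintro (q | q)
      · have := hp'.1.1 q.1 q.2
        simp only [Sum.elim_inl, LinearMap.neg_apply, he, Pi.zero_apply]
        linarith
      · have := hle q.1 q.2
        have := abs_le.1 (hwq q)
        simp only [PiLp.add_apply, Prod.mk.eta] at *
        simp only [Sum.elim_inr, hg, Pi.zero_apply]
        linarith)
    (by
      rintro (q | i | j)
      · by_cases hq : q ∈ Z
        · simpa [hq, he, hpZ q hq] using h0
        · have := heq q.1 q.2 hq
          simp only [PiLp.add_apply, Prod.mk.eta] at this
          simp only [Sum.elim_inl, hq, if_false, hg, ← this, Pi.zero_apply]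
          simpa using hwq q
      · simpa [he, hp'.1.2] using h0
      · simpa [he, hp'.2.2] using h0)
  have hpos : ∀ i j, 0 ≤ p' (i, j) := fun i j => by simpa [he] using h1 (.inl (i, j))
  refine ⟨p', mem_criticalSet hDX hDY ?_ ⟨u', v', fun i j => ?_, fun i j hij => ?_⟩,
    (norm_fst_le ((p', u', v') - (p, u, v))).trans h3⟩
  · rw [Set.mem_inter_iff, mem_C₁_iff, mem_C₂_iff]
    exact ⟨⟨hpos, fun i => by simpa [he] using h2 (.inr (.inl i))⟩, hpos,
      fun j => by simpa [he] using h2 (.inr (.inr j))⟩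
  · simpa [hg] using h1 (.inr (i, j))
  · have := h2 (.inl (i, j))
    by_cases hZ : (i, j) ∈ Z
    · exact absurd (by simpa [hZ, he] using this) hij
    · simpa [hZ, hg, sub_eq_zero] using this

theorem inner_sub_proj_le {E : Type*} [NormedAddCommGroup E] [InnerProductSpace ℝ E]
    [CompleteSpace E] {C : Set E} (hne : C.Nonempty) (hcl : IsClosed C) (hconv : Convex ℝ C)
    (x : E) : proj C x ∈ C ∧ ∀ y ∈ C, ⟪x - proj C x, y - proj C x⟫ ≤ 0 := by
  obtain ⟨q, hq, h⟩ := exists_norm_eq_iInf_of_complete_convex hne hcl.isComplete hconv x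
  have : IsProj C x q := ⟨hq, fun y hy => by
    rw [h]
    exact ciInf_le (f := fun w : C => ‖x - w‖)
      ⟨0, by rintro _ ⟨w, rfl⟩; exact norm_nonneg _⟩ ⟨y, hy⟩⟩
  rw [← (isProj_iff_eq_proj hne hcl hconv x q).1 this]
  exact ⟨hq, (norm_eq_iInf_iff_real_inner_le_zero hconv hq).1 h⟩

end GW

theorem proposition1 {n m : ℕ} (DX : Matrix (Fin n) (Fin n) ℝ) (DY : Matrix (Fin m) (Fin m) ℝ)
    (hDX : DX.IsSymm) (hDY : DY.IsSymm) (μ : Fin n → ℝ) (ν : Fin m → ℝ)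
    (hμ : μ ∈ stdSimplex ℝ (Fin n)) (hν : ν ∈ stdSimplex ℝ (Fin m)) :
    (GW.criticalSet DX DY μ ν).Nonempty ∧
      ∃ ε : ℝ, 0 < ε ∧ ∃ τ : ℝ, 0 < τ ∧ ∀ π : GW.MatSpace n m,
        GW.residual DX DY μ ν π ≤ ε →
          Metric.infDist π (GW.criticalSet DX DY μ ν) ≤ τ * GW.residual DX DY μ ν π := by
  refine ⟨GW.nonempty_criticalSet hDX hDY hμ hν, ?_⟩
  choose ε hε τ hτ H using GW.exists_error_bound_of_pattern hDX hDY μ ν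
  obtain ⟨Z₁, hZ₁⟩ := Finite.exists_min ε
  obtain ⟨Z₂, hZ₂⟩ := Finite.exists_max τ
  let A := (GW.sandwich DX DY).toContinuousLinearMap
  have hA : 0 < 1 + ‖A‖ := by positivity
  -- The factor `1 + ‖A‖` converts the residual into the size of `r + A r`; the leading `1` in `τ`
  -- pays for the step from `π` to `p`.
  refine ⟨ε Z₁ / (1 + ‖A‖), div_pos (hε _) hA, 1 + τ Z₂ * (1 + ‖A‖),
    add_pos one_pos (mul_pos (hτ _) hA), fun π hπ => ?_⟩
  let p := GW.proj (GW.C₁ m μ ∩ GW.C₂ n ν) (π + A π)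
  obtain ⟨hp, hpn⟩ := GW.inner_sub_proj_le (GW.nonempty_inter hμ hν) GW.isClosed_inter
    GW.convex_inter (π + A π)
  change p ∈ _ at hp
  change ∀ y ∈ _, inner ℝ (π + A π - p) (y - p) ≤ 0 at hpn
  have hr : GW.residual DX DY μ ν π = ‖π - p‖ := rfl
  rw [hr] at hπ ⊢
  have hw : ‖(π - p) + A (π - p)‖ ≤ (1 + ‖A‖) * ‖π - p‖ := by
    refine (norm_add_le _ _).trans ?_
    linarith [A.le_opNorm (π - p)]
  have hmem : GW.sandwich DX DY p + ((π - p) + A (π - p)) ∈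
      GW.multiplierCone {q | p q = 0} := by
    have : GW.sandwich DX DY p + ((π - p) + A (π - p)) = π + A π - p := by
      rw [map_sub]
      change A p + _ = _
      abel
    rw [this]
    exact GW.mem_multiplierCone_of_inner_le hp hpn
  obtain ⟨p', hp', hd⟩ := H {q | p q = 0} ((1 + ‖A‖) * ‖π - p‖) (by positivity)
    (((le_div_iff₀' hA).1 hπ).trans (hZ₁ _)) p hp (fun _ h => h) _ hw hmem
  calc Metric.infDist π (GW.criticalSet DX DY μ ν) ≤ dist π p' := Metric.infDist_le_dist_of_mem hp'
    _ ≤ ‖π - p‖ + ‖p' - p‖ := by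
      rw [← dist_eq_norm, ← dist_eq_norm, dist_comm p' p]
      exact dist_triangle _ _ _
    _ ≤ ‖π - p‖ + τ Z₂ * ((1 + ‖A‖) * ‖π - p‖) := by
      have := mul_le_mul_of_nonneg_right (hZ₂ {q | p q = 0})
        (by positivity : 0 ≤ (1 + ‖A‖) * ‖π - p‖)
      linarith
    _ = _ := by ring
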